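/- A class of groups is understood to be closed under isomorphism. For a class $\mathcal C$, a group $G$ is residually $\mathcal C$ if for every $g\in G\setminus\{e\}$ there are $Q\in\mathcal C$ and a surjective homomorphism $\varphi\colon G\to Q$ with $\varphi(g)\neq e$. A group is $\mathcal R$-by-$\mathcal C$ if it has a normal subgroup in $\mathcal R$ with quotient in $\mathcal C$. A root class is a class $\mathcal R$ that contains a non-trivial group, is closed under subgroups and finite direct products, and satisfies the Gruenberg condition: whenever $K\unlhd N\unlhd G$ with $G/N\in\mathcal R$ and $N/K\in\mathcal R$, there is $L\unlhd G$ with $L\le K$ and $G/L\in\mathcal R$. If $\mathcal C$ is closed under subgroups and finite direct products, the pro-$\mathcal C$ topology of $G$ is the group topology for which $\{N\unlhd G : G/N\in\mathcal C\}$ is a basis of neighbourhoods of $e$. Theorem. Let $A$ be a group, $H\le A$ a subgroup, and let $G=A*_H A$ be the double, i.e. the free product of two copies of $A$ amalgamated along $H$ via the identity of $H$. Let $\mathcal C$ be a class of groups that contains a root class $\mathcal R$, and suppose that 1. $\mathcal C$ is closed under subgroups and finite direct products; 2. every $\mathcal R$-by-$\mathcal C$ group belongs to $\mathcal C$; 3.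 for every group in $\mathcal C$ there is a group in $\mathcal R$ of the same cardinality. Then $G$ is residually $\mathcal C$ if and only if $A$ is residually $\mathcal C$ and $H$ is closed in the pro-$\mathcal C$ topology of $A$. -/

import Mathlib

open scoped Topology

universe u

/-- A class of groups: a predicate on groups that is closed under isomorphic images. -/
structure GroupClass : Type (u + 1) where
  /-- Membership of a group in the class. -/
  Mem : (G : Type u) → [Group G] → Prop
  iso : ∀ (G H : Type u) [Group G] [Group H], (G ≃* H) → Mem G → Mem H

namespace GroupClass

/-- Every group in `R` belongs to `C`. -/
def Contains (C R : GroupClass.{u}) : Prop :=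
  ∀ (G : Type u) [Group G], R.Mem G → C.Mem G

/-- The class contains a group with at least two elements. -/
def IsNontrivial (C : GroupClass.{u}) : Prop :=
  ∃ (G : Type u) (_ : Group G), C.Mem G ∧ Nontrivial G

/-- Closure under taking subgroups. -/
def ClosedUnderSubgroups (C : GroupClass.{u}) : Prop :=
  ∀ (G : Type u) [Group G], C.Mem G → ∀ S : Subgroup G, C.Mem S

/-- Closure under direct products of two (equivalently, of finitely many, at least one) groups.
A nonempty class that is closed under subgroups contains the trivial group, the empty product. -/
def ClosedUnderProducts (C : GroupClass.{u}) : Prop :=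
  ∀ (G H : Type u) [Group G] [Group H], C.Mem G → C.Mem H → C.Mem (G × H)

/-- Gruenberg's condition: for every chain `K ⊴ N ⊴ G` with `G ⧸ N` and `N ⧸ K` in the class,
there is a normal subgroup `L` of `G` contained in `K` with `G ⧸ L` in the class. -/
def GruenbergCondition (C : GroupClass.{u}) : Prop :=
  ∀ (G : Type u) [Group G] (N : Subgroup G) [N.Normal] (K : Subgroup N) [K.Normal],
    C.Mem (G ⧸ N) → C.Mem (N ⧸ K) →
      ∃ (L : Subgroup G) (_ : L.Normal), L ≤ K.map N.subtype ∧ C.Mem (G ⧸ L)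

/-- Root classes in the sense of Gruenberg. -/
structure IsRootClass (R : GroupClass.{u}) : Prop where
  nontrivial : R.IsNontrivial
  subgroups : R.ClosedUnderSubgroups
  products : R.ClosedUnderProducts
  gruenberg : R.GruenbergCondition

/-- `G` is `R`-by-`C`: it has a normal subgroup in `R` with quotient in `C`. -/
def IsBy (R C : GroupClass.{u}) (G : Type u) [Group G] : Prop :=
  ∃ (N : Subgroup G) (_ : N.Normal), R.Mem N ∧ C.Mem (G ⧸ N)

/-- `G` is residually `C`. -/
def Residually (C : GroupClass.{u}) (G : Type u) [Group G] : Prop :=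
  ∀ g : G, g ≠ 1 → ∃ (Q : Type u) (_ : Group Q) (φ : G →* Q),
    C.Mem Q ∧ Function.Surjective φ ∧ φ g ≠ 1

/-- The pro-`C` topology on `G`, generated by the cosets of the normal subgroups `N` with
`G ⧸ N` in `C`. (When `C` is closed under subgroups and finite products, these `N` form a
basis of neighbourhoods of `1`.) -/
abbrev proTopology (C : GroupClass.{u}) (G : Type u) [Group G] : TopologicalSpace G :=
  TopologicalSpace.generateFrom
    {U : Set G | ∃ (N : Subgroup G) (_ : N.Normal) (g : G),
      C.Mem (G ⧸ N) ∧ U = {x : G | g⁻¹ * x ∈ N}}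

end GroupClass

/-- The double `A *_H A`: the amalgamated free product of two copies of `A` along the inclusions
of the subgroup `H`. -/
abbrev AmalgamatedDouble {A : Type u} [Group A] (H : Subgroup A) : Type u :=
  Monoid.PushoutI (fun _ : Bool => H.subtype)

namespace GroupClass

variable {C R : GroupClass.{u}}

/-! If the double is residually `C`, so is its subgroup `A`. For `a ∉ H` the two copies of `a`
differ, and a quotient `Q` in `C` telling them apart gives a map `A → Q × Q` that sends `H` into the
diagonal and `a` off it; hence `H` is closed.

Conversely, elements of the first factor survive folding the double onto `A`. For an alternating
word that uses the second factor, closedness gives `φ : A → Q` with `Q` in `C` and every letter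
outside `φ(H)`. Send the first factor to the top group of the wreath product of `U` by `Q`, and
conjugate the second by a base element `t` that is constant on the left cosets of `φ(H)`. A base
coordinate of the image is then a reduced word in the values of `t`. As free groups are residually
`R`, some `U` in `R` and some `t` make it nontrivial (`exists_assignment`). The base group is in `R`
(`pi_mem`), so the wreath product is `R`-by-`C`. -/

theorem ClosedUnderSubgroups.mem_of_injective (hsub : C.ClosedUnderSubgroups) {G Q : Type u}
    [Group G] [Group Q] (f : G →* Q) (hf : Function.Injective f) (hQ : C.Mem Q) : C.Mem G :=
  C.iso _ _ (MonoidHom.ofInjective hf).symm (hsub Q hQ f.range)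

theorem ClosedUnderSubgroups.mem_quotient_ker (hsub : C.ClosedUnderSubgroups) {G Q : Type u}
    [Group G] [Group Q] (f : G →* Q) (hQ : C.Mem Q) : C.Mem (G ⧸ f.ker) :=
  hsub.mem_of_injective (QuotientGroup.kerLift f) (QuotientGroup.kerLift_injective f) hQ

/-- For a subgroup-closed class, surjectivity is not needed to witness residuality. -/
theorem ClosedUnderSubgroups.exists_surjective (hsub : C.ClosedUnderSubgroups) {G Q : Type u}
    [Group G] [Group Q] (f : G →* Q) (hQ : C.Mem Q) {g : G} (hg : f g ≠ 1) :
    ∃ (P : Type u) (_ : Group P) (φ : G →* P), C.Mem P ∧ Function.Surjective φ ∧ φ g ≠ 1 :=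
  ⟨f.range, inferInstance, f.rangeRestrict, hsub Q hQ _, f.rangeRestrict_surjective,
    fun h => hg (congrArg Subtype.val h)⟩

theorem IsRootClass.mem_punit (hR : R.IsRootClass) : R.Mem PUnit.{u + 1} := by
  obtain ⟨G, _, hG, _⟩ := hR.nontrivial
  exact hR.subgroups.mem_of_injective (1 : PUnit.{u + 1} →* G)
    (fun _ _ _ => Subsingleton.elim _ _) hG

end GroupClass

/-! ### Wreath products and root classes -/

/-- The action of `Y` on functions `Y → X` by right translation of the argument. -/
def shiftAut (X Y : Type*) [Group X] [Group Y] : Y →* MulAut (Y → X) where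
  toFun y :=
    { toFun := fun φ z => φ (z * y)
      invFun := fun φ z => φ (z * y⁻¹)
      left_inv := fun φ => by ext z; simp
      right_inv := fun φ => by ext z; simp
      map_mul' := fun _ _ => rfl }
  map_one' := by ext φ z; simp
  map_mul' a b := by ext φ z; simp [mul_assoc]

@[simp]
theorem shiftAut_apply {X Y : Type*} [Group X] [Group Y] (y z : Y) (φ : Y → X) :
    shiftAut X Y y φ z = φ (z * y) := rfl

/-- The unrestricted regular wreath product. -/
abbrev Wreath (X Y : Type*) [Group X] [Group Y] := (Y → X) ⋊[shiftAut X Y] Y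

namespace Wreath

variable {X Y : Type*} [Group X] [Group Y]

theorem mul_left_apply (a b : Wreath X Y) (y : Y) :
    (a * b).left y = a.left y * b.left (y * a.right) := rfl

theorem inv_left_apply (a : Wreath X Y) (y : Y) :
    a⁻¹.left y = (a.left (y * a.right⁻¹))⁻¹ := rfl

/-- The coordinate at `v` multiplies the contributions met along the path from `v` traced by the top
components. -/
theorem prod_left_eq_one (l : List (Wreath X Y)) (v : Y)
    (h : ∀ l₁ c l₂, l = l₁ ++ c :: l₂ → c.left (v * l₁.prod.right) = 1) :
    l.prod.left v = 1 := by
  induction l generalizing v with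
  | nil => rfl
  | cons c l ih =>
    rw [List.prod_cons, mul_left_apply]
    have h0 : c.left v = 1 := by simpa using h [] c l rfl
    rw [h0, one_mul]
    refine ih _ fun l₁ d l₂ hl => ?_
    have := h (c :: l₁) d l₂ (by simp [hl])
    simpa [mul_assoc] using this

/-- Evaluation at `1` of the elements of the base group. -/
def evalOne (X Y : Type*) [Group X] [Group Y] :
    (SemidirectProduct.rightHom : Wreath X Y →* Y).ker →* X where
  toFun n := n.1.left 1
  map_one' := rfl
  map_mul' a b := by
    have : a.1.right = 1 := a.2
    simp [this]

end Wreath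

namespace GroupClass

variable {C R : GroupClass.{u}}

/-- Gruenberg's condition is applied to the base group and the kernel of evaluation at `1`, a
subgroup whose normal core in the wreath product is trivial. -/
theorem IsRootClass.wreath_mem (hR : R.IsRootClass) {X Y : Type u} [Group X] [Group Y]
    (hX : R.Mem X) (hY : R.Mem Y) : R.Mem (Wreath X Y) := by
  obtain ⟨L, hLn, hLK, hL⟩ := hR.gruenberg (Wreath X Y)
    (SemidirectProduct.rightHom : Wreath X Y →* Y).ker (Wreath.evalOne X Y).ker
    (hR.subgroups.mem_quotient_ker _ hY) (hR.subgroups.mem_quotient_ker _ hX)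
  have key : ∀ g ∈ L, g.right = 1 ∧ g.left 1 = 1 := by
    intro g hg
    obtain ⟨n, hn, rfl⟩ := hLK hg
    exact ⟨n.2, hn⟩
  have hbot : L = ⊥ := by
    rw [eq_bot_iff]
    intro g hg
    rw [Subgroup.mem_bot]
    ext y
    -- Conjugating by the top element `y` moves the coordinate at `y` to the coordinate at `1`.
    · have := (key _ (hLn.conj_mem g hg (SemidirectProduct.inr y))).2
      simpa [Wreath.mul_left_apply] using this
    · exact (key g hg).1
  subst hbot
  exact R.iso _ _ QuotientGroup.quotientBot hL

/-- A Cartesian power of a group in a root class, indexed by a set which has the cardinality of a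
group of the class, is in the class. -/
theorem IsRootClass.pi_mem (hR : R.IsRootClass) {X Γ Y : Type u} [Group X] [Group Γ]
    (hX : R.Mem X) (hΓ : R.Mem Γ) (e : Γ ≃ Y) : R.Mem (Y → X) :=
  R.iso _ _ (MulEquiv.arrowCongr e (MulEquiv.refl X))
    (hR.subgroups.mem_of_injective (SemidirectProduct.inl : (Γ → X) →* Wreath X Γ)
      SemidirectProduct.inl_injective (hR.wreath_mem hX hΓ))

theorem IsRootClass.wreath_mem_of_isBy (hR : R.IsRootClass)
    (hsub : C.ClosedUnderSubgroups)
    (hext : ∀ (G : Type u) [Group G], GroupClass.IsBy R C G → C.Mem G)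
    (hcard : ∀ (G : Type u) [Group G], C.Mem G →
      ∃ (Γ : Type u) (_ : Group Γ), R.Mem Γ ∧ Cardinal.mk Γ = Cardinal.mk G)
    {X Y : Type u} [Group X] [Group Y] (hX : R.Mem X) (hY : C.Mem Y) : C.Mem (Wreath X Y) := by
  obtain ⟨Γ, _, hΓ, hc⟩ := hcard Y hY
  obtain ⟨e⟩ := Cardinal.eq.1 hc
  have h := R.iso _ _ (MonoidHom.ofInjective
    (SemidirectProduct.inl_injective (φ := shiftAut X Y))) (hR.pi_mem hX hΓ e)
  rw [SemidirectProduct.range_inl_eq_ker_rightHom] at h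
  exact hext _ ⟨_, inferInstance, h, hsub.mem_quotient_ker _ hY⟩

end GroupClass

/-! ### Free groups are residually in a root class -/

/-- The value of a signed letter under an assignment of group elements to letters. -/
def letterVal {S U : Type*} [Group U] (f : S → U) (c : S × Bool) : U :=
  cond c.2 (f c.1) (f c.1)⁻¹

theorem map_letterVal_prod {S U V : Type*} [Group U] [Group V] (p : U →* V) (f : S → U)
    (l : List (S × Bool)) :
    p (l.map (letterVal f)).prod = (l.map (letterVal (fun s => p (f s)))).prod := by
  rw [map_list_prod, List.map_map]
  congr 2
  ext ⟨s, _ | _⟩ <;> simp [letterVal]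

section MarkedEdge

variable {S U X : Type*} [Group U] [Group X]

open Classical in
/-- The lift of an assignment `g : S → U` to the wreath product, whose function components are
trivial except on the edge of the Cayley graph traversed by the letter `a` starting from `1`. -/
noncomputable def markEdge (g : S → U) (a : S × Bool) (x : X) (s : S) : Wreath X U :=
  ⟨fun v => if s = a.1 ∧ v = cond a.2 1 (g s)⁻¹ then x else 1, g s⟩

theorem markEdge_right_letter (g : S → U) (a c : S × Bool) (x : X) :
    (letterVal (markEdge g a x) c).right = letterVal g c := by
  obtain ⟨s, _ | _⟩ := c <;> rfl

theorem markEdge_right (g : S → U) (a : S × Bool) (x : X) (l : List (S × Bool)) :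
    (l.map (letterVal (markEdge g a x))).prod.right = (l.map (letterVal g)).prod :=
  map_letterVal_prod SemidirectProduct.rightHom (markEdge g a x) l

theorem markEdge_left_self (g : S → U) (a : S × Bool) {x : X} (hx : x ≠ 1) :
    (letterVal (markEdge g a x) a).left 1 ≠ 1 := by
  obtain ⟨s, _ | _⟩ := a
  · rw [letterVal, cond_false, Wreath.inv_left_apply]
    simpa [markEdge] using hx
  · simpa [letterVal, markEdge] using hx

/-- Only the two traversals of the marked edge contribute: forwards from `1`, or backwards from its
other end. -/
theorem markEdge_left_ne (g : S → U) (a c : S × Bool) (x : X) (v : U)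
    (h : (letterVal (markEdge g a x) c).left v ≠ 1) :
    (c = a ∧ v = 1) ∨ (c = (a.1, !a.2) ∧ v = letterVal g a) := by
  obtain ⟨s, b⟩ := a
  obtain ⟨t, d⟩ := c
  cases b <;> cases d <;>
    simp only [letterVal, markEdge, cond_true, cond_false, Wreath.inv_left_apply, ne_eq,
      inv_eq_one, ite_eq_right_iff, Classical.not_imp] at h <;>
    obtain ⟨⟨rfl, h⟩, -⟩ := h
  · left; simpa using h
  · right; simpa [letterVal] using h
  · right; exact ⟨rfl, by simpa [letterVal] using eq_inv_of_mul_eq_one_left h⟩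
  · left; simpa using h

end MarkedEdge

/-- Signed words without adjacent mutually inverse letters. -/
def IsReducedWord {S : Type*} (l : List (S × Bool)) : Prop :=
  l.IsChain fun a b => b ≠ (a.1, !a.2)

namespace GroupClass

variable {C R : GroupClass.{u}}

/-- Free groups are residually in any root class, in terms of reduced words. -/
theorem IsRootClass.exists_assignment (hR : R.IsRootClass) {S : Type u} (L : List (S × Bool))
    (hL : IsReducedWord L) :
    ∃ (U : Type u) (_ : Group U) (f : S → U), R.Mem U ∧
      ∀ M, M <:+: L → M ≠ [] → (M.map (letterVal f)).prod ≠ 1 := by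
  obtain ⟨X, _, hX, _⟩ := hR.nontrivial
  obtain ⟨x, hx⟩ := exists_ne (1 : X)
  induction L with
  | nil => exact ⟨X, inferInstance, fun _ => 1, hX, fun M hM h0 => (h0 (by simpa using hM)).elim⟩
  | cons a L ih =>
    obtain ⟨U, _, g, hU, hg⟩ := ih (List.IsChain.tail hL)
    refine ⟨Wreath X U, inferInstance, markEdge g a x, hR.wreath_mem hX hU, ?_⟩
    intro M hM hM0 h1
    -- The top component already handles subwords of the tail. A subword starting with the new
    -- letter must trace a closed path that crosses the marked edge only once.
    have hr : (M.map (letterVal g)).prod = 1 := by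
      rw [← markEdge_right g a x, h1]; rfl
    rcases List.infix_cons_iff.1 hM with hM | hM
    swap
    · exact hg M hM hM0 hr
    obtain ⟨b, M', rfl⟩ := List.exists_cons_of_ne_nil hM0
    obtain ⟨rfl, hM'⟩ := List.cons_prefix_cons.1 hM
    have hl := congrArg (fun z : Wreath X U => z.left 1) h1
    simp only [List.map_cons, List.prod_cons, Wreath.mul_left_apply, one_mul,
      SemidirectProduct.one_left, Pi.one_apply, markEdge_right_letter] at hl
    rw [Wreath.prod_left_eq_one _ _ ?_, mul_one] at hl
    · exact markEdge_left_self g b hx hl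
    intro l₁ c l₂ hsplit
    obtain ⟨M₁, N, rfl, rfl, hN⟩ := List.map_eq_append_iff.1 hsplit
    obtain ⟨d, M₂, rfl, rfl, rfl⟩ := List.map_eq_cons_iff.1 hN
    rw [markEdge_right]
    by_contra hne
    rcases markEdge_left_ne _ _ _ _ _ hne with ⟨-, h⟩ | ⟨h, h'⟩
    -- A second crossing in the same direction starts at `1`, so the rest of the closed path is a
    -- shorter loop.
    · refine hg (d :: M₂) ((List.suffix_append _ _).isInfix.trans hM'.isInfix) (by simp) ?_
      rw [List.map_cons, List.map_append, List.prod_cons, List.prod_append, ← mul_assoc, h,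
        one_mul] at hr
      exact hr
    -- A crossing back makes the part in between a loop, hence empty; then two adjacent letters
    -- cancel.
    · have hM₁ : M₁ = [] := by
        by_contra h0
        exact hg M₁ ((List.prefix_append _ _).trans hM').isInfix h0 (by simpa using h')
      subst hM₁
      obtain ⟨T, rfl⟩ := hM'
      exact (List.isChain_cons_cons.1 hL).1 h

/-! ### The pro-`C` topology -/

/-- Open sets of the pro-`C` topology contain, around each point, a fibre of a homomorphism to a
group in `C`. -/
theorem exists_fiber_subset_of_isOpen (hone : C.Mem PUnit.{u + 1})
    (hprod : C.ClosedUnderProducts) {A : Type u} [Group A] {V : Set A}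
    (hV : IsOpen[C.proTopology A] V) :
    ∀ x ∈ V, ∃ (Q : Type u) (_ : Group Q) (φ : A →* Q), C.Mem Q ∧ ∀ y, φ y = φ x → y ∈ V := by
  induction hV with
  | basic s hs =>
    obtain ⟨N, _, g, hN, rfl⟩ := hs
    intro x hx
    refine ⟨A ⧸ N, inferInstance, QuotientGroup.mk' N, hN, fun y hy => ?_⟩
    have h : x⁻¹ * y ∈ N := QuotientGroup.eq.1 hy.symm
    simpa [mul_assoc] using N.mul_mem hx h
  | univ => exact fun x _ => ⟨PUnit, inferInstance, 1, hone, fun _ _ => trivial⟩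
  | inter s t _ _ hs ht =>
    rintro x ⟨h1, h2⟩
    obtain ⟨Q, _, φ, hQ, hφ⟩ := hs x h1
    obtain ⟨P, _, ψ, hP, hψ⟩ := ht x h2
    refine ⟨Q × P, inferInstance, φ.prod ψ, hprod _ _ hQ hP, fun y hy => ?_⟩
    have := Prod.ext_iff.1 hy
    exact ⟨hφ y this.1, hψ y this.2⟩
  | sUnion T _ ih =>
    rintro x ⟨s, hs, hx⟩
    obtain ⟨Q, _, φ, hQ, hφ⟩ := ih s hs x hx
    exact ⟨Q, inferInstance, φ, hQ, fun y hy => ⟨s, hs, hφ y hy⟩⟩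

theorem isClosed_proTopology_of_separated (hsub : C.ClosedUnderSubgroups) {A : Type u} [Group A]
    {H : Subgroup A}
    (hsep : ∀ a, a ∉ H → ∃ (Q : Type u) (_ : Group Q) (φ : A →* Q), C.Mem Q ∧ φ a ∉ H.map φ) :
    IsClosed[C.proTopology A] (H : Set A) := by
  let := C.proTopology A
  rw [← isOpen_compl_iff, isOpen_iff_forall_mem_open]
  intro a ha
  obtain ⟨Q, _, φ, hQ, hφ⟩ := hsep a ha
  refine ⟨{x | a⁻¹ * x ∈ φ.ker}, fun x hx hxH => hφ ⟨x, hxH, ?_⟩,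
    TopologicalSpace.isOpen_generateFrom_of_mem
      ⟨φ.ker, inferInstance, a, hsub.mem_quotient_ker φ hQ, rfl⟩, by simp⟩
  have : φ (a⁻¹ * x) = 1 := hx
  rw [map_mul, map_inv, inv_mul_eq_one] at this
  exact this.symm

/-- Finitely many elements outside a closed subgroup are separated from it by one homomorphism. -/
theorem exists_separating_of_isClosed (hone : C.Mem PUnit.{u + 1})
    (hprod : C.ClosedUnderProducts) {A : Type u} [Group A] {H : Subgroup A}
    (hH : IsClosed[C.proTopology A] (H : Set A)) (l : List A) (hl : ∀ a ∈ l, a ∉ H) :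
    ∃ (Q : Type u) (_ : Group Q) (φ : A →* Q), C.Mem Q ∧ ∀ a ∈ l, φ a ∉ H.map φ := by
  induction l with
  | nil => exact ⟨PUnit, inferInstance, 1, hone, by simp⟩
  | cons a l ih =>
    obtain ⟨Q, _, φ, hQ, hφ⟩ := ih fun b hb => hl b (List.mem_cons_of_mem _ hb)
    obtain ⟨P, _, ψ, hP, hψ⟩ := exists_fiber_subset_of_isOpen hone hprod hH.isOpen_compl a
      (hl a List.mem_cons_self)
    refine ⟨Q × P, inferInstance, φ.prod ψ, hprod _ _ hQ hP, ?_⟩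
    rintro b hb ⟨h, hh, he⟩
    have he := Prod.ext_iff.1 he
    rcases List.mem_cons.1 hb with rfl | hb
    · exact hψ h he.2 hh
    · exact hφ b hb ⟨h, hh, he.1⟩

end GroupClass

/-! ### Normal forms in the double -/

namespace AmalgamatedDouble

open Monoid

variable {A : Type u} [Group A] (H : Subgroup A)

/-- The inclusion of one of the two factors. -/
abbrev incl (b : Bool) : A →* AmalgamatedDouble H :=
  PushoutI.of (φ := fun _ : Bool => H.subtype) b

theorem incl_injective (b : Bool) : Function.Injective (incl H b) :=
  PushoutI.of_injective (fun _ => H.subtype_injective) b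

variable {H}

theorem incl_eq_of_mem {a : A} (ha : a ∈ H) : incl H true a = incl H false a :=
  (PushoutI.of_apply_eq_base (fun _ : Bool => H.subtype) true ⟨a, ha⟩).trans
    (PushoutI.of_apply_eq_base (fun _ : Bool => H.subtype) false ⟨a, ha⟩).symm

theorem exists_lift {W : Type*} [Group W] (p q : A →* W) (h : ∀ a ∈ H, p a = q a) :
    ∃ F : AmalgamatedDouble H →* W, (∀ a, F (incl H true a) = p a) ∧
      ∀ a, F (incl H false a) = q a := by
  let f : Bool → A →* W := fun b => Bool.rec q p b
  have hf : ∀ b, (f b).comp H.subtype = p.comp H.subtype := by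
    rintro (_ | _)
    · ext a; exact (h a a.2).symm
    · rfl
  exact ⟨PushoutI.lift f (p.comp H.subtype) hf, fun a => PushoutI.lift_of _ _ _ _,
    fun a => PushoutI.lift_of _ _ _ _⟩

theorem incl_mul_inv_ne_one {a : A} (ha : a ∉ H) :
    incl H true a * (incl H false a)⁻¹ ≠ 1 := by
  intro h
  have h := mul_inv_eq_one.1 h
  have hmem : incl H true a ∈ (PushoutI.base (fun _ : Bool => H.subtype)).range := by
    rw [← PushoutI.inf_of_range_eq_base_range (φ := fun _ : Bool => H.subtype)
      (fun _ => H.subtype_injective) (i := true) (j := false) (by simp)]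
    exact ⟨⟨a, rfl⟩, ⟨a, h.symm⟩⟩
  obtain ⟨c, hc⟩ := hmem
  rw [← PushoutI.of_apply_eq_base (fun _ : Bool => H.subtype) true] at hc
  exact ha (incl_injective H true hc ▸ c.2)

/-- Every element is the product of an element of `H` and an alternating word. -/
theorem exists_word (g : AmalgamatedDouble H) :
    ∃ (h : A) (w : List (Σ _ : Bool, A)), w.IsChain (fun l l' => l.1 ≠ l'.1) ∧
      (∀ l ∈ w, l.2 ∉ H) ∧
      g = incl H true h * (w.map fun l => incl H l.1 l.2).prod := by
  obtain ⟨d⟩ := PushoutI.NormalWord.transversal_nonempty (fun _ : Bool => H.subtype)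
    (fun _ => H.subtype_injective)
  classical
  let w := PushoutI.NormalWord.equiv (d := d) g
  have hw : g = w.prod := (PushoutI.NormalWord.equiv (d := d).symm_apply_apply g).symm
  refine ⟨w.head, w.toList, w.chain_ne, ?_, ?_⟩
  · rintro ⟨i, a⟩ hl ha
    apply w.ne_one _ hl
    -- A letter in `H` would factor both as `a * 1` and as `1 * a` over the transversal, forcing `a
    -- = 1`.
    have h1 : (d.compl i).equiv a = (⟨⟨a, ⟨⟨a, ha⟩, rfl⟩⟩, ⟨1, d.one_mem i⟩⟩) :=
      (Equiv.eq_symm_apply _).1 (mul_one a).symm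
    have h2 : (d.compl i).equiv a = (⟨1, ⟨a, w.normalized i a hl⟩⟩) :=
      (Equiv.eq_symm_apply _).1 (one_mul a).symm
    have h3 := h1.symm.trans h2
    exact (congrArg (fun z => (z.2 : A)) h3).symm
  · rw [hw, PushoutI.NormalWord.prod, CoprodI.Word.prod, map_list_prod, List.map_map]
    congr 1
    exact (PushoutI.of_apply_eq_base (fun _ : Bool => H.subtype) true w.head).symm

end AmalgamatedDouble

/-! ### Reduced words from alternating words -/

section CosetPath

variable {A Q S : Type*} [Group A] [Group Q] (φ : A →* Q) (p : Q → S)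

/-- The signed word read off, from the position `y`, along an alternating word of the double whose
second factor is conjugated by a stable letter. -/
def cosetPath : Q → List (Σ _ : Bool, A) → List (S × Bool)
  | _, [] => []
  | y, ⟨true, a⟩ :: w => cosetPath (y * φ a) w
  | y, ⟨false, a⟩ :: w => (p y, false) :: (p (y * φ a), true) :: cosetPath (y * φ a) w

theorem cosetPath_ne_nil (w : List (Σ _ : Bool, A)) (hw : ∃ l ∈ w, l.1 = false) (y : Q) :
    cosetPath φ p y w ≠ [] := by
  induction w generalizing y with
  | nil => simp at hw
  | cons l w ih =>
    obtain ⟨_ | _, a⟩ := l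
    · simp [cosetPath]
    · exact ih (by simpa using hw) _

/-- Consecutive stable letters are separated by exactly one letter of `A`, which changes the coset.
The second conjunct carries the induction past a pending positive letter `s`: it must differ from
the coset where the next negative letter is read, which is one step later if the word begins in the
first factor. -/
theorem cosetPath_isReducedWord (w : List (Σ _ : Bool, A))
    (hw : w.IsChain fun l l' => l.1 ≠ l'.1) (hp : ∀ l ∈ w, ∀ y, p (y * φ l.2) ≠ p y) (y : Q) :
    IsReducedWord (cosetPath φ p y w) ∧
      ∀ s, (∀ l ∈ w.head?, (l.1 = false → s ≠ p y) ∧ (l.1 = true → s ≠ p (y * φ l.2))) →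
        IsReducedWord ((s, true) :: cosetPath φ p y w) := by
  induction w generalizing y with
  | nil => exact ⟨List.IsChain.nil, fun s _ => List.IsChain.singleton _⟩
  | cons l w ih =>
    rw [List.isChain_cons] at hw
    have ih := ih hw.2 fun l hl => hp l (List.mem_cons_of_mem _ hl)
    have hhead := hw.1
    have hpl := hp l List.mem_cons_self y
    obtain ⟨_ | _, a⟩ := l
    · have h1 : IsReducedWord (cosetPath φ p y (⟨false, a⟩ :: w)) := by
        refine List.isChain_cons_cons.2 ⟨fun h => hpl (Prod.ext_iff.1 h).1, (ih _).2 _ ?_⟩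
        intro l hl
        exact ⟨fun h => (hhead l hl h.symm).elim,
          fun _ => (hp l (List.mem_cons_of_mem _ (List.mem_of_mem_head? hl)) _).symm⟩
      refine ⟨h1, fun s hs => List.isChain_cons_cons.2 ⟨fun h => ?_, h1⟩⟩
      exact (hs _ rfl).1 rfl (Prod.ext_iff.1 h).1.symm
    · refine ⟨(ih _).1, fun s hs => (ih _).2 s fun l hl => ?_⟩
      exact ⟨fun _ => (hs _ rfl).2 rfl, fun h => (hhead l hl h.symm).elim⟩

end CosetPath

namespace AmalgamatedDouble

variable {A : Type u} [Group A] {H : Subgroup A}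

/-- The homomorphism to a wreath product that sends the first factor to the top group and
conjugates the second factor by an element of the base group centralized by `H`. -/
theorem exists_hom_wreath {Q U S : Type*} [Group Q] [Group U] (φ : A →* Q) (p : Q → S)
    (hp : ∀ h ∈ H, ∀ y, p (y * φ h) = p y) (f : S → U) :
    ∃ F : AmalgamatedDouble H →* Wreath U Q,
      (∀ a, F (incl H true a) = SemidirectProduct.inr (φ a)) ∧
      ∀ (w : List (Σ _ : Bool, A)) (y : Q),
        (F (w.map fun l => incl H l.1 l.2).prod).left y =
          ((cosetPath φ p y w).map (letterVal f)).prod := by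
  let t : Wreath U Q := SemidirectProduct.inl fun y => f (p y)
  let i : A →* Wreath U Q := SemidirectProduct.inr.comp φ
  obtain ⟨F, hF, hF'⟩ := exists_lift (H := H) i ((MulAut.conj t⁻¹).toMonoidHom.comp i) (by
    intro a ha
    -- Constancy of `p` along `H` makes `t` commute with the image of `H`, so the two maps agree
    -- there.
    have : t * i a = i a * t := by
      ext y
      · simp [t, i, hp a ha]
      · simp [t, i]
    simp [mul_assoc, ← this])
  refine ⟨F, hF, fun w => ?_⟩
  induction w with
  | nil => intro y; simp [cosetPath]
  | cons l w ih =>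
    intro y
    obtain ⟨_ | _, a⟩ := l
    · rw [List.map_cons, List.prod_cons, map_mul, hF', Wreath.mul_left_apply, ih]
      simp [cosetPath, letterVal, t, i, mul_assoc]
    · rw [List.map_cons, List.prod_cons, map_mul, hF, Wreath.mul_left_apply, ih]
      simp [cosetPath, i]

end AmalgamatedDouble

theorem theorem9 (C R : GroupClass.{u})
    (hR : R.IsRootClass)
    (hRC : C.Contains R)
    (hsub : C.ClosedUnderSubgroups)
    (hprod : C.ClosedUnderProducts)
    (hext : ∀ (G : Type u) [Group G], GroupClass.IsBy R C G → C.Mem G)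
    (hcard : ∀ (G : Type u) [Group G], C.Mem G →
      ∃ (Γ : Type u) (_ : Group Γ), R.Mem Γ ∧ Cardinal.mk Γ = Cardinal.mk G)
    (A : Type u) [Group A] (H : Subgroup A) :
    C.Residually (AmalgamatedDouble H) ↔
      C.Residually A ∧ IsClosed[C.proTopology A] (H : Set A) := by
  have hone : C.Mem PUnit.{u + 1} := hRC _ hR.mem_punit
  constructor
  · intro hG
    refine ⟨fun a ha => ?_, GroupClass.isClosed_proTopology_of_separated hsub fun a ha => ?_⟩
    · obtain ⟨Q, _, φ, hQ, -, hφ⟩ := hG (AmalgamatedDouble.incl H true a)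
        ((map_ne_one_iff _ (AmalgamatedDouble.incl_injective H true)).2 ha)
      exact hsub.exists_surjective (φ.comp (AmalgamatedDouble.incl H true)) hQ hφ
    · obtain ⟨Q, _, φ, hQ, -, hφ⟩ := hG _ (AmalgamatedDouble.incl_mul_inv_ne_one ha)
      refine ⟨Q × Q, inferInstance, (φ.comp (AmalgamatedDouble.incl H true)).prod
        (φ.comp (AmalgamatedDouble.incl H false)), hprod _ _ hQ hQ, ?_⟩
      rintro ⟨h, hh, he⟩
      have he := Prod.ext_iff.1 he
      have h1 : φ (AmalgamatedDouble.incl H true h) = φ (AmalgamatedDouble.incl H true a) := he.1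
      have h2 : φ (AmalgamatedDouble.incl H false h) = φ (AmalgamatedDouble.incl H false a) :=
        he.2
      apply hφ
      rw [map_mul, map_inv, ← h1, ← h2, AmalgamatedDouble.incl_eq_of_mem hh, mul_inv_cancel]
  · rintro ⟨hA, hH⟩ g hg
    obtain ⟨h, w, hchain, hwH, rfl⟩ := AmalgamatedDouble.exists_word g
    by_cases hw : ∃ l ∈ w, l.1 = false
    · obtain ⟨Q, _, φ, hQ, hφ⟩ := GroupClass.exists_separating_of_isClosed hone hprod hH
        (w.map Sigma.snd) (List.forall_mem_map.2 hwH)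
      let p : Q → Q ⧸ H.map φ := fun y => y
      -- The leading element `h` of the first factor only shifts the starting position from `1` to
      -- `φ h`.
      have hred := (cosetPath_isReducedWord φ p w hchain (fun l hl y he => by
        have := QuotientGroup.eq.1 he.symm
        rw [inv_mul_cancel_left] at this
        exact hφ l.2 (List.mem_map_of_mem hl) this) (1 * φ h)).1
      obtain ⟨U, _, f, hU, hf⟩ := hR.exists_assignment _ hred
      obtain ⟨F, hF, hF'⟩ := AmalgamatedDouble.exists_hom_wreath (H := H) φ p
        (fun a ha y => QuotientGroup.mk_mul_of_mem y (Subgroup.mem_map_of_mem φ ha)) f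
      refine hsub.exists_surjective F (hR.wreath_mem_of_isBy hsub hext hcard hU hQ) fun h1 => ?_
      have h1 := congrArg (fun z : Wreath U Q => z.left 1) h1
      simp only [map_mul, hF, Wreath.mul_left_apply, hF', SemidirectProduct.left_inr,
        SemidirectProduct.right_inr, Pi.one_apply, one_mul, SemidirectProduct.one_left] at h1
      rw [one_mul] at hf
      exact hf _ List.infix_rfl (cosetPath_ne_nil φ p w hw _) h1
    · have hmem : AmalgamatedDouble.incl H true h *
          (w.map fun l => AmalgamatedDouble.incl H l.1 l.2).prod ∈
          (AmalgamatedDouble.incl H true).range := by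
        refine mul_mem ⟨h, rfl⟩ (list_prod_mem fun x hx => ?_)
        obtain ⟨⟨b, a⟩, hl, rfl⟩ := List.mem_map.1 hx
        cases b
        · exact (hw ⟨_, hl, rfl⟩).elim
        · exact ⟨a, rfl⟩
      obtain ⟨a, ha⟩ := hmem
      rw [← ha] at hg ⊢
      obtain ⟨Q, _, φ, hQ, -, hφ⟩ := hA a fun h => hg (by rw [h, map_one])
      obtain ⟨F, hF, -⟩ := AmalgamatedDouble.exists_lift (H := H) φ φ fun _ _ => rfl
      exact hsub.exists_surjective F hQ (by rwa [hF])
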